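/- Conventions: A \emph{smooth curve} over a field $K$ is a separated scheme of finite type over $K$ that is geometrically integral (geometrically irreducible and geometrically reduced) and smooth of relative dimension $1$ over $K$. A field $K$ is called \emph{ample} (or \emph{large}) if every smooth curve over $K$ which has a $K$-rational point has infinitely many $K$-rational points. For a subfield $K_0\subseteq K$, a set $X\subseteq K$ is \emph{existentially $K_0$-definable} if there is an existential first-order formula $\varphi(x)$ in the language of rings with parameters from $K_0$ (a block of existential quantifiers followed by a quantifier-free formula) such that $X=\{a\in K : K\models\varphi(a)\}$. The algebraic closure of $K_0$ is denoted by $\widetilde{K_0}$, and the cardinality of a set $S$ by $|S|$. \textbf{Lemma.} Let $K$ be a perfect ample field and $K_0\subseteq K$ a subfield. Let $X\subseteq K$ be an existentially $K_0$-definable set with $X\not\subseteq\widetilde{K_0}$ (that is, some element of $X$ is transcendental over $K_0$). Then $$|X\smallsetminus K_1|=|K|$$ for every proper subfield $K_1$ of $K$. -/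

import Mathlib

universe u

/-- A morphism `f : C ⟶ Spec K`, for a field `K`, makes `C` a smooth curve over `K`: a separated,
quasi-compact scheme, smooth of relative dimension one (in particular of finite type) and
geometrically integral (geometrically irreducible and geometrically reduced) over `K`. -/
structure IsSmoothCurve {K : Type u} [Field K] {C : AlgebraicGeometry.Scheme.{u}}
    (f : C ⟶ AlgebraicGeometry.Spec (CommRingCat.of K)) : Prop where
  isSeparated : AlgebraicGeometry.IsSeparated f
  quasiCompact : AlgebraicGeometry.QuasiCompact f
  smooth : AlgebraicGeometry.SmoothOfRelativeDimension 1 f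
  geometricallyIntegral : AlgebraicGeometry.GeometricallyIntegral f

open CategoryTheory in
/-- The `K`-rational points of a `K`-scheme `f : C ⟶ Spec K`: the sections of `f`. -/
def RationalPoints {K : Type u} [Field K] {C : AlgebraicGeometry.Scheme.{u}}
    (f : C ⟶ AlgebraicGeometry.Spec (CommRingCat.of K)) : Type u :=
  {s : AlgebraicGeometry.Spec (CommRingCat.of K) ⟶ C // s ≫ f = 𝟙 _}

/-- A field `K` is ample (also called large) if every smooth curve over `K` that has a `K`-rational
point has infinitely many of them. -/
def IsAmpleField (K : Type u) [Field K] : Prop :=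
  ∀ (C : AlgebraicGeometry.Scheme.{u}) (f : C ⟶ AlgebraicGeometry.Spec (CommRingCat.of K)),
    IsSmoothCurve f → Nonempty (RationalPoints f) → Infinite (RationalPoints f)

open FirstOrder in
/-- A subset `X` of a ring `R` is existentially `A`-definable if it is defined by an existential
formula in one free variable in the language of rings, with parameters from `A`. -/
def ExistentiallyDefinable {R : Type*} [CommRing R] (A : Set R) (X : Set R) : Prop :=
  letI := Ring.compatibleRingOfRing R
  ∃ φ : Language.ring[[A]].Formula (Fin 1),
    Language.BoundedFormula.IsExistential φ ∧ ∀ x : R, x ∈ X ↔ φ.Realize (fun _ => x)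

/-! ### Smooth affine curves from algebras embedded in power series rings -/

section RationalPoints

open Polynomial PowerSeries CategoryTheory TensorProduct

/-! Let `x ∈ X` be transcendental over `K₀`. Its membership in `X` is certified by finitely many
elements `S` of `K`: existential witnesses and inverses of nonzero differences of terms. Choose a
relatively algebraically closed `F ⊆ K` containing `K₀`, with `x` transcendental over `F` and `K`
algebraic over `F(x)`. Replacing `x` by a root `z` with `z ^ q ^ n = x` makes `S` separable over
`F(z)`, so `S` lies in an étale `F[X]`-algebra `R ⊆ K` with `X ↦ z`. Every `F`-homomorphism `R → K`
then sends `z` into `Y = {y | y ^ q ^ n ∈ X}`.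

Pull `R` back along the lines `T ↦ z + c * T` for finitely many `c` and tensor the results: this
gives an étale `K[T]`-algebra with a rational point over `T = 0`. By Hensel lifting that point lies
on a smooth, geometrically integral curve, so ampleness gives infinitely many points, only finitely
many over `0`. Hence some `t ≠ 0` puts all `z + c * t` in `Y` (`IsAmpleField.exists_shift`).

Such affine images force `Y` minus a proper subfield to be large: ratios of differences of three of
its elements recover every `c ∈ K` up to finite data (`mk_diff_subfield_eq_of_exists_affine_image`).
Frobenius, bijective on `K`, carries this back to `X`. -/

/-- Base change of an embedding into a power series ring along a field extension. -/
noncomputable def PowerSeries.tensorMap {K A : Type*} (L : Type*) [Field K] [CommRing A]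
    [Algebra K A] [Field L] [Algebra K L] (φ : A →ₐ[K] K⟦X⟧) : A ⊗[K] L →ₐ[K] L⟦X⟧ :=
  Algebra.TensorProduct.lift ((PowerSeries.mapAlgHom (Algebra.ofId K L)).comp φ)
    ((Algebra.ofId L L⟦X⟧).restrictScalars K) fun _ _ => Commute.all _ _

/-- A `K`-basis of `L` is an `A`-basis of `A ⊗[K] L`; compare coefficients of each power of `X` and
use linear independence over `K`. -/
lemma PowerSeries.tensorMap_injective {K A : Type*} (L : Type*) [Field K] [CommRing A]
    [Algebra K A] [Field L] [Algebra K L] (φ : A →ₐ[K] K⟦X⟧) (hφ : Function.Injective φ) :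
    Function.Injective (tensorMap L φ) := by
  rw [injective_iff_map_eq_zero]
  intro z hz
  let b := Module.Basis.ofVectorSpace K L
  let B := Algebra.TensorProduct.basis A b
  rw [← B.linearCombination_repr z, Finsupp.linearCombination_apply] at hz ⊢
  rw [Finsupp.sum, map_sum] at hz
  refine Finset.sum_eq_zero fun i hi => ?_
  suffices φ (B.repr z i) = 0 by
    simp [(map_eq_zero_iff φ hφ).1 this]
  ext n
  have h := congrArg (PowerSeries.coeff n) hz
  rw [map_sum, map_zero] at h
  have h' : ∑ j ∈ (B.repr z).support, PowerSeries.coeff n (φ (B.repr z j)) • b j = 0 := by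
    rw [← h]
    refine Finset.sum_congr rfl fun j _ => ?_
    have : PowerSeries.mapAlgHom (Algebra.ofId K L) (φ (B.repr z j)) =
        PowerSeries.map (algebraMap K L) (φ (B.repr z j)) := rfl
    simp [B, tensorMap, Algebra.TensorProduct.basis_apply, Algebra.ofId_apply, Algebra.smul_def,
      PowerSeries.coeff_mul_C, this]
  simpa using linearIndependent_iff'.1 b.linearIndependent _ _ h' i hi

lemma Polynomial.isStandardSmoothOfRelativeDimension_one (K : Type*) [Field K] :
    Algebra.IsStandardSmoothOfRelativeDimension 1 K K[X] := by
  let b : Module.Basis Unit K[X] (Ω[K[X]⁄K]) :=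
    (Module.Basis.singleton Unit K[X]).map (KaehlerDifferential.polynomialEquiv K).symm
  have hb : Set.range b ⊆ Set.range (KaehlerDifferential.D K K[X]) := by
    rintro _ ⟨i, rfl⟩
    exact ⟨Polynomial.X, by simp [b]⟩
  have : Algebra.IsStandardSmooth K K[X] := .of_basis_kaehlerDifferential b hb
  rw [Algebra.IsStandardSmoothOfRelativeDimension.iff_of_isStandardSmooth]
  simp [rank_eq_card_basis b]

section

open AlgebraicGeometry

/-- Every base change `A ⊗[K] L` embeds in the domain `L⟦X⟧`. -/
lemma geometricallyIntegral_of_injective {K A : Type u} [Field K] [CommRing A]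
    [Algebra K A] (φ : A →ₐ[K] K⟦X⟧) (hφ : Function.Injective φ) :
    GeometricallyIntegral (Spec.map (CommRingCat.ofHom (algebraMap K A))) := by
  constructor
  rw [geometrically_iff_of_commRing]
  intro L _ _ Y fst snd h
  have : IsDomain (A ⊗[K] L) :=
    (PowerSeries.tensorMap_injective L φ hφ).isDomain (PowerSeries.tensorMap L φ).toRingHom
  let e := h.isoPullback ≪≫ pullbackSpecIso K A L
  have : Nonempty Y := ⟨e.inv (Nonempty.some inferInstance)⟩
  exact isIntegral_of_isOpenImmersion e.hom

lemma smoothOfRelativeDimension_one_of_etale_polynomial {K A : Type u} [Field K] [CommRing A]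
    [Algebra K A] [Algebra K[X] A] [IsScalarTower K K[X] A] [Algebra.Etale K[X] A] :
    SmoothOfRelativeDimension 1 (Spec.map (CommRingCat.ofHom (algebraMap K A))) := by
  have : Algebra.IsStandardSmoothOfRelativeDimension 0 K[X] A :=
    Algebra.Etale.iff_isStandardSmoothOfRelativeDimension_zero.1 inferInstance
  have := Polynomial.isStandardSmoothOfRelativeDimension_one K
  have := Algebra.IsStandardSmoothOfRelativeDimension.trans 1 0 K K[X] A
  rw [HasRingHomProperty.Spec_iff (P := @SmoothOfRelativeDimension 1)]
  exact RingHom.locally_of RingHom.isStandardSmoothOfRelativeDimension_respectsIso _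
    ((RingHom.isStandardSmoothOfRelativeDimension_algebraMap 1).2 this)

lemma IsAmpleField.infinite_algHom {K : Type u} [Field K] (hK : IsAmpleField K) {A : Type u}
    [CommRing A] [Algebra K A] [Algebra K[X] A] [IsScalarTower K K[X] A] [Algebra.Etale K[X] A]
    (φ : A →ₐ[K] K⟦X⟧) (hφ : Function.Injective φ) : Infinite (A →ₐ[K] K) := by
  have hC : IsSmoothCurve (Spec.map (CommRingCat.ofHom (algebraMap K A))) :=
    ⟨inferInstance, inferInstance, smoothOfRelativeDimension_one_of_etale_polynomial,
      geometricallyIntegral_of_injective φ hφ⟩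
  let e : (A →ₐ[K] K) → RationalPoints (Spec.map (CommRingCat.ofHom (algebraMap K A))) :=
    fun σ => ⟨Spec.map (CommRingCat.ofHom σ.toRingHom), by
      rw [← Spec.map_comp, ← CommRingCat.ofHom_comp, ← Spec.map_id]
      congr 1
      ext x
      exact σ.commutes x⟩
  have he : Function.Surjective e := by
    rintro ⟨s, hs⟩
    obtain ⟨ψ, rfl⟩ := Spec.map_surjective s
    rw [← Spec.map_comp, ← Spec.map_id] at hs
    have hs := Spec.map_injective hs
    refine ⟨⟨ψ.hom, fun r => ?_⟩, rfl⟩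
    exact congr($(hs).hom r)
  -- The rational point required by ampleness is the constant coefficient of `φ`.
  have := hK _ _ hC ⟨e ((AlgHom.mk (PowerSeries.constantCoeff (R := K)) fun r => by
    simp).comp φ)⟩
  exact Infinite.of_surjective e he

end

end RationalPoints

/-! ### Lifting a rational point to a power series point; use of ampleness -/

section PowerSeriesPoints

open Polynomial PowerSeries

instance PowerSeries.isAdicComplete_span_X (K : Type*) [CommRing K] :
    IsAdicComplete (Ideal.span {(PowerSeries.X : K⟦X⟧)}) K⟦X⟧ where
  haus' f hf := by
    ext n
    have h := hf (n + 1)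
    rw [SModEq.zero, smul_eq_mul, Ideal.mul_top, Ideal.span_singleton_pow,
      Ideal.mem_span_singleton, PowerSeries.X_pow_dvd_iff] at h
    simpa using h n n.lt_succ_self
  prec' f hf := by
    -- The terms agree modulo `X ^ (k + 1)` from index `k + 1` on, so the `k`-th coefficient is
    -- stable from there.
    refine ⟨PowerSeries.mk fun k => PowerSeries.coeff k (f (k + 1)), fun n => ?_⟩
    rw [SModEq.sub_mem, smul_eq_mul, Ideal.mul_top, Ideal.span_singleton_pow,
      Ideal.mem_span_singleton, PowerSeries.X_pow_dvd_iff]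
    intro m hm
    have h := hf (Nat.succ_le_of_lt hm)
    rw [SModEq.sub_mem, smul_eq_mul, Ideal.mul_top, Ideal.span_singleton_pow,
      Ideal.mem_span_singleton, PowerSeries.X_pow_dvd_iff] at h
    have := h m m.lt_succ_self
    rw [map_sub, sub_eq_zero] at this
    rw [map_sub, PowerSeries.coeff_mk, ← this, sub_self]

section

variable {K B : Type*} [Field K] [CommRing B] [Algebra K[X] B]

/-- A rational point over `0` of an étale algebra over `K[X]` extends to a power series point. -/
lemma exists_powerSeries_lift [Algebra K B] [IsScalarTower K K[X] B]
    [Algebra.FormallySmooth K[X] B] (ψ : B →ₐ[K] K)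
    (hψ : ψ (algebraMap K[X] B Polynomial.X) = 0) :
    ∃ φ : B →ₐ[K[X]] K⟦X⟧, ∀ b, PowerSeries.constantCoeff (φ b) = ψ b := by
  have hψ' : ∀ p : K[X], ψ (algebraMap K[X] B p) = p.coeff 0 := by
    intro p
    have h : ψ.comp (IsScalarTower.toAlgHom K K[X] B) = Polynomial.aeval 0 :=
      Polynomial.algHom_ext (by simpa using hψ)
    simpa [Polynomial.coeff_zero_eq_aeval_zero] using congr($h p)
  -- Since `ψ` kills `X`, it is `K[X]`-linear as a map to `K⟦X⟧ ⧸ (X)`; formal smoothness and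
  -- completeness lift it.
  let f : B →ₐ[K[X]] K⟦X⟧ ⧸ Ideal.span {(PowerSeries.X : K⟦X⟧)} :=
    { ((Ideal.Quotient.mk _).comp (PowerSeries.C (R := K))).comp ψ.toRingHom with
      commutes' := fun p => by
        change Ideal.Quotient.mk _ (PowerSeries.C (ψ (algebraMap K[X] B p))) =
          Ideal.Quotient.mk _ (p : K⟦X⟧)
        rw [hψ', Ideal.Quotient.eq, Ideal.mem_span_singleton, PowerSeries.X_dvd_iff]
        simp }
  obtain ⟨φ, hφ⟩ := Algebra.FormallySmooth.exists_mkₐ_comp_eq_of_isAdicComplete f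
  refine ⟨φ, fun b => ?_⟩
  have h : Ideal.Quotient.mk (Ideal.span {(PowerSeries.X : K⟦X⟧)}) (φ b) =
    Ideal.Quotient.mk _ (PowerSeries.C (ψ b)) := congr($hφ b)
  rw [Ideal.Quotient.eq, Ideal.mem_span_singleton, PowerSeries.X_dvd_iff] at h
  simpa [sub_eq_zero] using h

/-- If `B` is unramified over `K[X]`, a power series point of `B` is injective on the local ring
at its special point. -/
lemma exists_mul_eq_zero_of_powerSeries_point [Algebra.FormallyUnramified K[X] B]
    [Algebra.FiniteType K[X] B] (φ : B →ₐ[K[X]] K⟦X⟧) (b : B) (hb : φ b = 0) :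
    ∃ s, PowerSeries.constantCoeff (φ s) ≠ 0 ∧ s * b = 0 := by
  let q : Ideal B := RingHom.ker ((PowerSeries.constantCoeff (R := K)).comp φ.toRingHom)
  have hmem : ∀ s, s ∈ q ↔ PowerSeries.constantCoeff (φ s) = 0 := fun s => Iff.rfl
  have : q.IsPrime := RingHom.ker_isPrime _
  let S := Localization.AtPrime q
  have hu : ∀ y : q.primeCompl, IsUnit (φ y) := fun y => by
    rw [PowerSeries.isUnit_iff_constantCoeff, isUnit_iff_ne_zero]
    exact fun h => y.2 ((hmem _).2 h)
  let Φ : S →+* K⟦X⟧ := IsLocalization.lift (M := q.primeCompl) (g := φ.toRingHom) hu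
  have hΦ : ∀ c, Φ (algebraMap B S c) = φ c := fun c => IsLocalization.lift_eq _ _
  let p : Ideal K[X] := q.under K[X]
  have hp : p = Ideal.span {Polynomial.X} := by
    ext f
    rw [Ideal.mem_span_singleton, Polynomial.X_dvd_iff]
    change φ (algebraMap K[X] B f) ∈ RingHom.ker (PowerSeries.constantCoeff (R := K)) ↔ _
    rw [φ.commutes]
    change PowerSeries.constantCoeff (f : K⟦X⟧) = 0 ↔ _
    simp
  have : q.LiesOver p := ⟨rfl⟩
  have : IsNoetherianRing B := Algebra.FiniteType.isNoetherianRing K[X] B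
  have : IsNoetherianRing S := IsLocalization.isNoetherianRing q.primeCompl S inferInstance
  have hunr : Algebra.IsUnramifiedAt K[X] q := inferInstance
  let := Localization.AtPrime.algebraOfLiesOver p q
  have hmax := ((Algebra.isUnramifiedAt_iff_map_eq K[X] p q).1 hunr).2
  rw [hp, Ideal.map_span, Set.image_singleton] at hmax
  set x := algebraMap K[X] S Polynomial.X with hx
  have hΦx : Φ x = PowerSeries.X := by
    rw [hx, IsScalarTower.algebraMap_apply K[X] B S, hΦ, φ.commutes]
    exact Polynomial.coe_X
  -- Unramifiedness makes `x` generate the maximal ideal of `S`. A kernel element is thus `x` times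
  -- another kernel element, and Krull's intersection theorem finishes.
  have key : ∀ s, Φ s = 0 → ∀ n, s ∈ Ideal.span {x} ^ n := by
    intro s hs n
    induction n with
    | zero => simp
    | succ n ih =>
      rw [Ideal.span_singleton_pow, Ideal.mem_span_singleton] at ih ⊢
      obtain ⟨u, rfl⟩ := ih
      rw [map_mul, map_pow, hΦx] at hs
      have hs : Φ u = 0 := (mul_eq_zero.1 hs).resolve_left (pow_ne_zero _ PowerSeries.X_ne_zero)
      have : u ∈ IsLocalRing.maximalIdeal S := fun h => by simpa [hs] using h.map Φ
      rw [← hmax, Ideal.mem_span_singleton] at this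
      rw [pow_succ]
      exact mul_dvd_mul_left _ this
  have h0 : algebraMap B S b = 0 := by
    have := Ideal.iInf_pow_eq_bot_of_isLocalRing (Ideal.span {x})
      (hmax ▸ (IsLocalRing.maximalIdeal.isMaximal S).ne_top)
    rw [← Ideal.mem_bot, ← this, Ideal.mem_iInf]
    exact key _ (by rw [hΦ, hb])
  obtain ⟨s, hs⟩ := (IsLocalization.map_eq_zero_iff q.primeCompl S b).1 h0
  exact ⟨s, fun h => s.2 ((hmem _).2 h), hs⟩


/-- The kernel is finitely generated, so a product of annihilators of its generators kills all of
it; inverting `g` makes the power series point injective. -/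
lemma exists_localizationAway_injective [Algebra.FormallyUnramified K[X] B]
    [Algebra.FiniteType K[X] B] (φ : B →ₐ[K[X]] K⟦X⟧) :
    ∃ g : B, PowerSeries.constantCoeff (φ g) ≠ 0 ∧ ∀ b, φ b = 0 → g * b = 0 := by
  have : IsNoetherianRing B := Algebra.FiniteType.isNoetherianRing K[X] B
  obtain ⟨T, hT⟩ := IsNoetherian.noetherian (RingHom.ker φ)
  have hT' : ∀ t ∈ T, φ t = 0 := fun t ht => by
    have : t ∈ RingHom.ker φ := hT ▸ Submodule.subset_span ht
    exact this
  choose! s hs using fun t (ht : t ∈ T) => exists_mul_eq_zero_of_powerSeries_point φ t (hT' t ht)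
  refine ⟨∏ t ∈ T, s t, ?_, fun b hb => ?_⟩
  · rw [map_prod, map_prod, Finset.prod_ne_zero_iff]
    exact fun t ht => (hs t ht).1
  · have hb' : b ∈ Submodule.span B (T : Set B) := hT ▸ hb
    clear hb
    induction hb' using Submodule.span_induction with
    | mem t ht =>
      obtain ⟨c, hc⟩ := Finset.dvd_prod_of_mem s ht
      rw [hc, mul_right_comm, (hs t ht).2, zero_mul]
    | zero => simp
    | add a b _ _ ha hb => rw [mul_add, ha, hb, add_zero]
    | smul r b _ hb => rw [smul_eq_mul, mul_left_comm, hb, mul_zero]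

end

/-- Over an ample field, an étale algebra over `K[X]` with a rational point above `0` has
infinitely many rational points. -/
lemma IsAmpleField.infinite_algHom_of_etale {K : Type u} [Field K] (hK : IsAmpleField K)
    {B : Type u} [CommRing B] [Algebra K B] [Algebra K[X] B] [IsScalarTower K K[X] B]
    [Algebra.Etale K[X] B] (ψ : B →ₐ[K] K) (hψ : ψ (algebraMap K[X] B Polynomial.X) = 0) :
    Infinite (B →ₐ[K] K) := by
  obtain ⟨φ, -⟩ := exists_powerSeries_lift ψ hψ
  obtain ⟨g, hg, hg'⟩ := exists_localizationAway_injective φ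
  have hu : ∀ y : Submonoid.powers g, IsUnit (φ y) := by
    rintro ⟨_, n, rfl⟩
    simpa [PowerSeries.isUnit_iff_constantCoeff] using fun h => absurd h hg
  let A := Localization.Away g
  let Φ : A →ₐ[K[X]] K⟦X⟧ := IsLocalization.liftAlgHom (M := Submonoid.powers g) hu
  have hΦ : Function.Injective Φ := by
    rw [injective_iff_map_eq_zero]
    intro a ha
    obtain ⟨⟨b, s⟩, hs⟩ := IsLocalization.surj (Submonoid.powers g) a
    have hb : φ b = 0 := by
      have := congrArg Φ hs
      rw [map_mul, ha, zero_mul] at this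
      rw [this]
      exact (IsLocalization.lift_eq _ _).symm
    have h0 : algebraMap B A b = 0 :=
      (IsLocalization.map_eq_zero_iff (Submonoid.powers g) A b).2
        ⟨⟨g, Submonoid.mem_powers g⟩, hg' b hb⟩
    rw [h0] at hs
    exact (IsLocalization.map_units A s).mul_left_eq_zero.1 hs
  have : IsScalarTower K K[X] A := .of_algebraMap_eq fun r => by
    rw [IsScalarTower.algebraMap_apply K B A, IsScalarTower.algebraMap_apply K K[X] B,
      ← IsScalarTower.algebraMap_apply K[X] B A]
  have : Algebra.Etale B A := .of_isLocalizationAway g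
  have : Algebra.Etale K[X] A := .comp K[X] B A
  have := hK.infinite_algHom (Φ.restrictScalars K) hΦ
  refine Infinite.of_injective (fun σ : A →ₐ[K] K => σ.comp (IsScalarTower.toAlgHom K B A))
    fun σ τ h => ?_
  exact IsLocalization.algHom_ext (Submonoid.powers g) h

end PowerSeriesPoints

/-! ### Moving a point along several lines at once -/

section Shift

open Polynomial TensorProduct

/-- An unramified algebra of finite type over `K[X]` has finitely many rational points over `0`. -/
lemma finite_algHom_map_X_eq_zero {K : Type*} [Field K] {B : Type*} [CommRing B] [Algebra K B]
    [Algebra K[X] B] [IsScalarTower K K[X] B] [Algebra.FormallyUnramified K[X] B]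
    [Algebra.FiniteType K[X] B] :
    {σ : B →ₐ[K] K | σ (algebraMap K[X] B Polynomial.X) = 0}.Finite := by
  let : Algebra K[X] K := (Polynomial.evalRingHom 0).toAlgebra
  have hev : ∀ p : K[X], algebraMap K[X] K p = p.eval 0 := fun _ => rfl
  -- `Q` is the fibre over `0`: unramified of finite type over a field, hence finite-dimensional.
  let Q := K ⊗[K[X]] B
  have : Module.Finite K Q := Algebra.FormallyUnramified.finite_of_free K Q
  have : Finite (Q →ₐ[K] K) := inferInstance
  have key : ∀ σ : B →ₐ[K] K, σ (algebraMap K[X] B Polynomial.X) = 0 →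
      ∃ ρ : Q →ₐ[K] K, ∀ b, ρ (1 ⊗ₜ b) = σ b := by
    intro σ hσ
    have h : σ.comp (IsScalarTower.toAlgHom K K[X] B) = Polynomial.aeval 0 :=
      Polynomial.algHom_ext (by simpa using hσ)
    let σ' : B →ₐ[K[X]] K := { σ.toRingHom with
      commutes' := fun p => by
        simpa [hev, Polynomial.aeval_def, Polynomial.coeff_zero_eq_eval_zero] using congr($h p) }
    exact ⟨Algebra.TensorProduct.lift (AlgHom.id K K) σ' fun _ _ => Commute.all _ _,
      fun b => by rw [Algebra.TensorProduct.lift_tmul, map_one, one_mul]; rfl⟩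
  choose ρ hρ using key
  refine Set.finite_coe_iff.1 (Finite.of_injective (fun σ => ρ σ.1 σ.2) ?_)
  rintro ⟨σ, hσ⟩ ⟨τ, hτ⟩ h
  ext b
  exact (hρ σ hσ b).symm.trans ((congrArg (fun r : Q →ₐ[K] K => r (1 ⊗ₜ b)) h).trans (hρ τ hτ b))

lemma IsAmpleField.exists_algHom_map_X_ne_zero {K : Type u} [Field K] (hK : IsAmpleField K)
    {B : Type u} [CommRing B] [Algebra K B] [Algebra K[X] B] [IsScalarTower K K[X] B]
    [Algebra.Etale K[X] B] (ψ : B →ₐ[K] K) (hψ : ψ (algebraMap K[X] B Polynomial.X) = 0) :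
    ∃ σ : B →ₐ[K] K, σ (algebraMap K[X] B Polynomial.X) ≠ 0 := by
  by_contra! h
  have := hK.infinite_algHom_of_etale ψ hψ
  exact Set.infinite_univ (finite_algHom_map_X_eq_zero.subset fun σ _ => h σ)

/-- Finitely many pullbacks of an étale algebra along affine lines through a given point have a
common étale refinement with a point over `0`. -/
lemma exists_etale_refinement {K k : Type u} [Field K] [Field k] [Algebra k K] {R : Type u}
    [CommRing R] [Algebra k R] [Algebra k[X] R] [IsScalarTower k k[X] R] [Algebra.Etale k[X] R]
    (ev : R →ₐ[k] K) (l : List K) :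
    ∃ (B : Type u) (_ : CommRing B) (_ : Algebra K B) (_ : Algebra K[X] B)
      (_ : IsScalarTower K K[X] B) (_ : Algebra.Etale K[X] B) (ψ : B →ₐ[K] K),
      ψ (algebraMap K[X] B X) = 0 ∧ ∀ c ∈ l, ∃ ι : R →+* B,
        (∀ a : k, ι (algebraMap k R a) = algebraMap K B (algebraMap k K a)) ∧
        ι (algebraMap k[X] R X) =
          algebraMap K B (ev (algebraMap k[X] R X)) + algebraMap K B c * algebraMap K[X] B X := by
  induction l with
  | nil =>
    exact ⟨K[X], inferInstance, inferInstance, inferInstance, inferInstance, inferInstance,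
      Polynomial.aeval 0, by simp, by simp⟩
  | cons c l ih =>
    obtain ⟨B, _, _, _, _, _, ψ, hψ, hB⟩ := ih
    set x := ev (algebraMap k[X] R X) with hx
    let y := algebraMap K B x + algebraMap K B c * algebraMap K[X] B X
    -- These structures send `X` to `x + c * T` in `B` and to `x` in `K`. They agree under `ψ`,
    -- where `T = 0`, so `ψ` and `ev` glue to a point of `B ⊗[k[X]] R`.
    let : Algebra k[X] B :=
      (Polynomial.eval₂RingHom ((algebraMap K B).comp (algebraMap k K)) y).toAlgebra
    let : Algebra k[X] K := (Polynomial.eval₂RingHom (algebraMap k K) x).toAlgebra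
    have hCB : ∀ a : k, algebraMap k[X] B (C a) = algebraMap K B (algebraMap k K a) := fun a =>
      Polynomial.eval₂_C _ _
    have hXB : algebraMap k[X] B X = y := Polynomial.eval₂_X _ _
    have hCK : ∀ a : k, algebraMap k[X] K (C a) = algebraMap k K a := fun a =>
      Polynomial.eval₂_C _ _
    have hXK : algebraMap k[X] K X = x := Polynomial.eval₂_X _ _
    have hψy : ψ y = x := by simp [y, hψ]
    let ψ₁ : B →ₐ[k[X]] K := { ψ.toRingHom with
      commutes' := fun p => by
        have h : ψ.toRingHom.comp (algebraMap k[X] B) = algebraMap k[X] K :=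
          Polynomial.ringHom_ext (fun a => by
            simp [hCB, hCK]) (by
            rw [hXK, RingHom.comp_apply, hXB]; exact hψy)
        exact congr($h p) }
    let ev₁ : R →ₐ[k[X]] K := { ev.toRingHom with
      commutes' := fun p => by
        have h : ev.toRingHom.comp (algebraMap k[X] R) = algebraMap k[X] K :=
          Polynomial.ringHom_ext (fun a => by
            have : algebraMap k[X] R (C a) = algebraMap k R a :=
              (IsScalarTower.algebraMap_apply k k[X] R a).symm
            simp [this, hCK]) (by
            rw [hXK]; rfl)
        exact congr($h p) }
    let Ψ : B ⊗[k[X]] R →ₐ[k[X]] K := Algebra.TensorProduct.lift ψ₁ ev₁ fun _ _ => Commute.all _ _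
    have hΨ : ∀ b, Ψ (b ⊗ₜ 1) = ψ b := fun b => by
      rw [Algebra.TensorProduct.lift_tmul, map_one, mul_one]; rfl
    have hK : ∀ r : K, algebraMap K (B ⊗[k[X]] R) r = algebraMap K B r ⊗ₜ 1 := fun r => rfl
    have hKX : ∀ r : K[X], algebraMap K[X] (B ⊗[k[X]] R) r = algebraMap K[X] B r ⊗ₜ 1 :=
      fun r => rfl
    refine ⟨B ⊗[k[X]] R, inferInstance, inferInstance, inferInstance, ?_, ?_,
      { Ψ.toRingHom with
        commutes' := fun r => ?_ }, ?_, ?_⟩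
    · exact .of_algebraMap_eq fun r => by
        rw [hK, hKX, ← IsScalarTower.algebraMap_apply]
    · have : IsScalarTower K[X] B (B ⊗[k[X]] R) := .of_algebraMap_eq fun r => rfl
      exact .comp K[X] B _
    · exact (hΨ _).trans (ψ.commutes r)
    · exact (hΨ _).trans hψ
    · intro d hd
      rcases List.mem_cons.1 hd with rfl | hd
      · have hι : ∀ p : k[X], (1 : B) ⊗ₜ[k[X]] algebraMap k[X] R p = algebraMap k[X] B p ⊗ₜ 1 :=
          fun p => (Algebra.TensorProduct.algebraMap_apply' p).symm
        refine ⟨(Algebra.TensorProduct.includeRight : R →ₐ[k[X]] B ⊗[k[X]] R).toRingHom,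
          fun a => ?_, ?_⟩
        · rw [IsScalarTower.algebraMap_apply k k[X] R]
          refine (hι _).trans ?_
          rw [Polynomial.algebraMap_eq, hCB, hK]
        · refine (hι _).trans ?_
          rw [hXB, hK, hK, hKX, Algebra.TensorProduct.tmul_mul_tmul, mul_one,
            ← TensorProduct.add_tmul]
      · obtain ⟨ι, h₁, h₂⟩ := hB d hd
        refine ⟨(Algebra.TensorProduct.includeLeftRingHom : B →+* B ⊗[k[X]] R).comp ι,
          fun a => ?_, ?_⟩
        · rw [RingHom.comp_apply, h₁]; rfl
        · rw [RingHom.comp_apply, h₂, hK, hK, hKX, Algebra.TensorProduct.tmul_mul_tmul, mul_one,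
            ← TensorProduct.add_tmul]; rfl

/-- Over an ample field, a rational point of a curve étale over the affine line can be moved
along finitely many prescribed directions with a common nonzero parameter. -/
lemma IsAmpleField.exists_shift {K k : Type u} [Field K] (hK : IsAmpleField K) [Field k]
    [Algebra k K] {R : Type u} [CommRing R] [Algebra k R] [Algebra k[X] R]
    [IsScalarTower k k[X] R] [Algebra.Etale k[X] R] (ev : R →ₐ[k] K) (l : List K) :
    ∃ t : K, t ≠ 0 ∧ ∀ c ∈ l, ∃ σ : R →ₐ[k] K,
      σ (algebraMap k[X] R X) = ev (algebraMap k[X] R X) + c * t := by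
  obtain ⟨B, _, _, _, _, _, ψ, hψ, hB⟩ := exists_etale_refinement ev l
  obtain ⟨σ, hσ⟩ := hK.exists_algHom_map_X_ne_zero ψ hψ
  refine ⟨_, hσ, fun c hc => ?_⟩
  obtain ⟨ι, h₁, h₂⟩ := hB c hc
  exact ⟨{ σ.toRingHom.comp ι with commutes' := fun a => by simp [h₁] }, by simp [h₂]⟩

end Shift

/-! ### Specialization of existential formulas -/

section Specialization

section

open FirstOrder Language Ring

variable {K : Type u} [Field K] [CompatibleRing K] {K₀ : Subfield K}

/-- Terms with parameters in a subfield are evaluated compatibly with algebra homomorphisms. -/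
lemma exists_forall_term_realize_eq {α : Type*} {R : Type*} [CommRing R] [Algebra K₀ R]
    (t : Language.ring[[(K₀ : Set K)]].Term α) (v : α → R) :
    ∃ a : R, ∀ ρ : R →ₐ[K₀] K, t.realize (fun i => ρ (v i)) = ρ a := by
  induction t with
  | var i => exact ⟨v i, fun ρ => rfl⟩
  | @func n f ts ih =>
    choose a ha using ih
    rcases f with f | f
    · cases f with
      | add => exact ⟨a 0 + a 1, fun ρ => by
          rw [map_add, ← ha, ← ha]
          exact CompatibleRing.funMap_add _⟩
      | mul => exact ⟨a 0 * a 1, fun ρ => by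
          rw [map_mul, ← ha, ← ha]
          exact CompatibleRing.funMap_mul _⟩
      | neg => exact ⟨-a 0, fun ρ => by
          rw [map_neg, ← ha]
          exact CompatibleRing.funMap_neg _⟩
      | zero => exact ⟨0, fun ρ => by
          rw [map_zero]
          exact CompatibleRing.funMap_zero _⟩
      | one => exact ⟨1, fun ρ => by
          rw [map_one]
          exact CompatibleRing.funMap_one _⟩
    · match n, f with
      | 0, f => exact ⟨algebraMap K₀ R (show K₀ from f), fun ρ =>
          (ρ.commutes (show K₀ from f)).symm⟩

/-- The truth value of a quantifier-free formula at a point of a field depends on finitely many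
elements. -/
lemma isQF_realize_iff {α : Type*} {n : ℕ}
    {φ : Language.ring[[(K₀ : Set K)]].BoundedFormula α n} (hφ : φ.IsQF) (v : α → K)
    (xs : Fin n → K) :
    ∃ S : Finset K, ∀ (R : Type u) [CommRing R] [Algebra K₀ R] (ρ σ : R →ₐ[K₀] K),
      Function.Injective ρ → (S : Set K) ⊆ Set.range ρ →
      ∀ (v' : α → R) (xs' : Fin n → R), (∀ i, ρ (v' i) = v i) → (∀ i, ρ (xs' i) = xs i) →
      (φ.Realize v xs ↔ φ.Realize (fun i => σ (v' i)) (fun i => σ (xs' i))) := by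
  classical
  induction hφ with
  | falsum => exact ⟨∅, fun R _ _ ρ σ _ _ _ _ _ _ => Iff.rfl⟩
  | of_isAtomic h =>
    cases h with
    | rel R ts => rcases R with R | R <;> cases R
    | equal t₁ t₂ =>
      -- The inverse keeps an inequality true under `σ`; if the terms are equal it is just `0`.
      refine ⟨{(t₁.realize (Sum.elim v xs) - t₂.realize (Sum.elim v xs))⁻¹},
        fun R _ _ ρ σ hρ hS v' xs' hv hxs => ?_⟩
      obtain ⟨a₁, h₁⟩ := exists_forall_term_realize_eq t₁ (Sum.elim v' xs')
      obtain ⟨a₂, h₂⟩ := exists_forall_term_realize_eq t₂ (Sum.elim v' xs')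
      have e₁ : Sum.elim v xs = fun i => ρ (Sum.elim v' xs' i) := by
        ext (i | i) <;> simp [hv, hxs]
      have e₂ : Sum.elim (fun i => σ (v' i)) (fun i => σ (xs' i)) =
          fun i => σ (Sum.elim v' xs' i) := by
        ext (i | i) <;> simp
      rw [BoundedFormula.realize_bdEqual, BoundedFormula.realize_bdEqual, e₁, e₂, h₁, h₂, h₁, h₂]
      rw [e₁, h₁, h₂, Finset.coe_singleton, Set.singleton_subset_iff] at hS
      obtain ⟨b, hb⟩ := hS
      refine ⟨fun h => congrArg σ (hρ h), fun h => ?_⟩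
      by_contra hne
      have : (a₁ - a₂) * b = 1 := hρ (by
        rw [map_mul, hb, map_sub, map_one, mul_inv_cancel₀ (sub_ne_zero.2 hne)])
      have := congrArg σ this
      rw [map_mul, map_sub, h, sub_self, zero_mul, map_one] at this
      exact zero_ne_one this
  | imp _ _ ih₁ ih₂ =>
    obtain ⟨S₁, h₁⟩ := ih₁
    obtain ⟨S₂, h₂⟩ := ih₂
    refine ⟨S₁ ∪ S₂, fun R _ _ ρ σ hρ hS v' xs' hv hxs => ?_⟩
    rw [Finset.coe_union, Set.union_subset_iff] at hS
    rw [BoundedFormula.realize_imp, BoundedFormula.realize_imp,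
      h₁ R ρ σ hρ hS.1 v' xs' hv hxs, h₂ R ρ σ hρ hS.2 v' xs' hv hxs]

/-- The truth of an existential formula at a point of a field depends on finitely many elements. -/
lemma isExistential_realize_of_realize {α : Type*} {n : ℕ}
    {φ : Language.ring[[(K₀ : Set K)]].BoundedFormula α n} (hφ : φ.IsExistential) (v : α → K)
    (xs : Fin n → K) (h : φ.Realize v xs) :
    ∃ S : Finset K, ∀ (R : Type u) [CommRing R] [Algebra K₀ R] (ρ σ : R →ₐ[K₀] K),
      Function.Injective ρ → (S : Set K) ⊆ Set.range ρ →
      ∀ (v' : α → R) (xs' : Fin n → R), (∀ i, ρ (v' i) = v i) → (∀ i, ρ (xs' i) = xs i) →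
      φ.Realize (fun i => σ (v' i)) (fun i => σ (xs' i)) := by
  classical
  induction hφ with
  | of_isQF hφ =>
    obtain ⟨S, hS⟩ := isQF_realize_iff hφ v xs
    exact ⟨S, fun R _ _ ρ σ hρ hS' v' xs' hv hxs => (hS R ρ σ hρ hS' v' xs' hv hxs).1 h⟩
  | ex _ ih =>
    obtain ⟨y, hy⟩ := BoundedFormula.realize_ex.1 h
    obtain ⟨S, hS⟩ := ih _ hy
    refine ⟨insert y S, fun R _ _ ρ σ hρ hS' v' xs' hv hxs => ?_⟩
    rw [Finset.coe_insert, Set.insert_subset_iff] at hS'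
    obtain ⟨⟨z, hz⟩, hS'⟩ := hS'
    refine BoundedFormula.realize_ex.2 ⟨σ z, ?_⟩
    convert hS R ρ σ hρ hS' v' (Fin.snoc xs' z) hv ?_ using 1
    · ext i
      refine Fin.lastCases ?_ (fun i => ?_) i <;> simp
    · intro i
      refine Fin.lastCases ?_ (fun i => ?_) i <;> simp [hz, hxs]

end

/-- A point of an existentially definable set specializes along homomorphisms defined on
a sufficiently large subring. -/
lemma ExistentiallyDefinable.exists_specialization {K : Type u} [Field K] {K₀ : Subfield K}
    {X : Set K} (hX : ExistentiallyDefinable (K₀ : Set K) X) {x : K} (hx : x ∈ X) :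
    ∃ S : Finset K, ∀ (R : Type u) [CommRing R] [Algebra K₀ R] (ρ σ : R →ₐ[K₀] K),
      Function.Injective ρ → (S : Set K) ⊆ Set.range ρ → ∀ r : R, ρ r = x → σ r ∈ X := by
  let := FirstOrder.Ring.compatibleRingOfRing K
  obtain ⟨φ, hφ, h⟩ := hX
  obtain ⟨S, hS⟩ := isExistential_realize_of_realize hφ (fun _ => x) default ((h x).1 hx)
  refine ⟨S, fun R _ _ ρ σ hρ hS' r hr => (h _).2 ?_⟩
  have := hS R ρ σ hρ hS' (fun _ => r) default (fun _ => hr) (fun i => i.elim0)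
  unfold FirstOrder.Language.Formula.Realize
  convert this

end Specialization

/-! ### Separable and étale models of finitely generated subfields -/

section FieldTheory

open Polynomial
open scoped IntermediateField.algebraAdjoinAdjoin

section

variable {k K : Type u} [Field k] [Field K] [Algebra k K]

/-- A transcendental element can be completed to a transcendence basis: over the algebraic closure
of the field generated by the remaining elements, all of `K` is algebraic over the rational
function field generated by the given element. -/
lemma exists_intermediateField_isAlgebraic_adjoin_simple {x : K} (hx : Transcendental k x) :
    ∃ F : IntermediateField k K, Transcendental F x ∧ (∀ y : K, IsAlgebraic F y → y ∈ F) ∧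
      Algebra.IsAlgebraic (IntermediateField.adjoin F {x}) K := by
  have hx' : AlgebraicIndepOn k id {x} :=
    (algebraicIndependent_singleton_iff (⟨x, rfl⟩ : ({x} : Set K))).2 hx
  obtain ⟨s, hs, hb⟩ := exists_isTranscendenceBasis_superset hx'
  have hxs : x ∈ s := hs rfl
  let F₀ := IntermediateField.adjoin k (s \ {x})
  have hF₀ : Transcendental F₀ x := by
    have h := hb.1.transcendental_adjoin (i := ⟨x, hxs⟩) (s := {⟨x, hxs⟩}ᶜ) (by simp)
    have himg : ((↑) : s → K) '' {⟨x, hxs⟩}ᶜ = s \ {x} := by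
      ext y
      simp
    rw [himg] at h
    exact fun h' => h ((IsFractionRing.isAlgebraic_iff (Algebra.adjoin k (s \ {x})) F₀ K).2 h')
  -- Relative algebraic closedness keeps `p`-power roots of elements of `F` inside `F`, as
  -- `exists_frobenius_root_isSeparable` requires.
  let F := (algebraicClosure F₀ K).restrictScalars k
  have hF : Transcendental F x := hF₀.algebraicClosure
  refine ⟨F, hF, fun y hy => ?_, ?_⟩
  · have hy : IsAlgebraic (algebraicClosure F₀ K) y := hy
    exact mem_algebraicClosure_iff.2 (hy.restrictScalars F₀)
  · have h := hb.isAlgebraic_field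
    rw [Subtype.range_coe] at h
    have hle : IntermediateField.adjoin k s ≤
        (IntermediateField.adjoin F {x}).restrictScalars k := by
      rw [IntermediateField.adjoin_le_iff]
      intro y hy
      by_cases hyx : y = x
      · exact hyx ▸ IntermediateField.mem_adjoin_simple_self F x
      · have : y ∈ F₀ := IntermediateField.subset_adjoin _ _ ⟨hy, hyx⟩
        have : y ∈ F := (algebraicClosure F₀ K).algebraMap_mem ⟨y, this⟩
        exact (IntermediateField.adjoin F {x}).algebraMap_mem ⟨y, this⟩
    let := (IntermediateField.inclusion hle).toRingHom.toAlgebra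
    have : IsScalarTower (IntermediateField.adjoin k s)
        ((IntermediateField.adjoin F {x}).restrictScalars k) K := .of_algebraMap_eq fun _ => rfl
    exact ⟨fun y => (h.1 y).extendScalars
      (S := (IntermediateField.adjoin F {x}).restrictScalars k)
      (IntermediateField.inclusion hle).injective⟩

/-- Over a perfect field, finitely many elements algebraic over `k(x)` become separable after
replacing `x` by a `p`-power root. -/
lemma exists_frobenius_root_isSeparable [PerfectField K] (q : ℕ) [ExpChar K q]
    (hk : ∀ y : K, IsAlgebraic k y → y ∈ (algebraMap k K).range) (x : K)
    [Algebra.IsAlgebraic (IntermediateField.adjoin k {x}) K] (S : Finset K) :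
    ∃ (n : ℕ) (z : K), z ^ q ^ n = x ∧
      ∀ s ∈ S, IsSeparable (IntermediateField.adjoin k {z}) s := by
  let M := IntermediateField.adjoin k {x}
  let N := separableClosure M K
  have : ExpChar N q := IntermediateField.expChar' N q
  have hpow : ∀ s : K, ∃ n : ℕ, s ^ q ^ n ∈ N := fun s => by
    obtain ⟨n, y, hy⟩ := IsPurelyInseparable.pow_mem N q s
    exact ⟨n, hy ▸ y.2⟩
  choose m hm using hpow
  let n := S.sup m
  let φ := iterateFrobeniusEquiv K q n
  have hφ : ∀ y, φ y = y ^ q ^ n := fun y => iterateFrobenius_def q n y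
  let z := φ.symm x
  have hz : z ^ q ^ n = x := by rw [← hφ, φ.apply_symm_apply]
  refine ⟨n, z, hz, fun s hs => ?_⟩
  have hsN : φ s ∈ N := by
    have hle : m s ≤ n := Finset.le_sup (f := m) hs
    rw [hφ, ← Nat.add_sub_cancel' hle, pow_add, pow_mul]
    exact pow_mem (hm s) _
  have hmem : ∀ y ∈ M, φ.symm y ∈ IntermediateField.adjoin k {z} := by
    intro y hy
    induction hy using IntermediateField.adjoin_induction with
    | mem y hy =>
      rw [Set.mem_singleton_iff.1 hy]
      exact IntermediateField.mem_adjoin_simple_self k z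
    | algebraMap a =>
      have : IsAlgebraic k (φ.symm (algebraMap k K a)) := by
        have : IsAlgebraic k (φ.symm (algebraMap k K a) ^ q ^ n) := by
          rw [← hφ, φ.apply_symm_apply]
          exact isAlgebraic_algebraMap a
        exact this.of_pow (pow_pos (expChar_pos K q) n)
      obtain ⟨b, hb⟩ := hk _ this
      rw [← hb]
      exact IntermediateField.algebraMap_mem _ b
    | add a b _ _ ha hb => rw [map_add]; exact add_mem ha hb
    | inv a _ ha => rw [map_inv₀]; exact inv_mem ha
    | mul a b _ _ ha hb => rw [map_mul]; exact mul_mem ha hb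
  -- Inverse Frobenius maps `k(x)` into `k(z)` and turns the separable minimal polynomial of `φ s`
  -- into a separable polynomial vanishing at `s`.
  let j : M →+* IntermediateField.adjoin k {z} :=
    ((φ.symm : K →+* K).comp (algebraMap M K)).codRestrict _ fun y => hmem y y.2
  have hsep : (minpoly M (φ s)).Separable := mem_separableClosure_iff.1 hsN
  have hroot : aeval s ((minpoly M (φ s)).map j) = 0 := by
    have h := congrArg φ.symm (minpoly.aeval M (φ s))
    rw [map_zero, Polynomial.aeval_def, ← RingEquiv.coe_toRingHom, Polynomial.hom_eval₂,
      RingEquiv.coe_toRingHom, φ.symm_apply_apply] at h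
    rw [Polynomial.aeval_def, Polynomial.eval₂_map]
    exact h
  exact (hsep.map (f := j)).of_dvd (minpoly.dvd _ _ hroot)

/-- Finitely many separable elements over a rational function field `k(z)` are contained in an
étale algebra over `k[z]`. -/
lemma exists_etale_of_isSeparable {z : K} (hz : Transcendental k z) (S : Finset K)
    (hS : ∀ s ∈ S, IsSeparable (IntermediateField.adjoin k {z}) s) :
    ∃ (R : Type u) (_ : CommRing R) (_ : Algebra k R) (_ : Algebra k[X] R)
      (_ : IsScalarTower k k[X] R) (_ : Algebra.Etale k[X] R) (ρ : R →ₐ[k] K),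
      Function.Injective ρ ∧ (S : Set K) ⊆ Set.range ρ ∧ ρ (algebraMap k[X] R X) = z := by
  classical
  let T : Set K := ↑(insert z S)
  have hzT : z ∈ T := Finset.mem_insert_self z S
  let A := Algebra.adjoin k T
  let M := IntermediateField.adjoin k {z}
  let E := IntermediateField.adjoin k T
  have hME : M ≤ E := IntermediateField.adjoin.mono _ _ _ (Set.singleton_subset_iff.2 hzT)
  let zA : A := ⟨z, Algebra.subset_adjoin hzT⟩
  let zM : M := ⟨z, IntermediateField.mem_adjoin_simple_self k z⟩
  let : Algebra k[X] A := (Polynomial.aeval zA).toAlgebra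
  let : Algebra k[X] M := (Polynomial.aeval zM).toAlgebra
  let : Algebra k[X] E := (Polynomial.aeval (IntermediateField.inclusion hME zM)).toAlgebra
  let : Algebra M E := (IntermediateField.inclusion hME).toAlgebra
  have : IsScalarTower k k[X] A := .of_algebraMap_eq fun r => (Polynomial.aeval_C zA r).symm
  have : IsScalarTower k k[X] M := .of_algebraMap_eq fun r => (Polynomial.aeval_C zM r).symm
  have : IsScalarTower k[X] M E := .of_algebraMap_eq' <| by
    ext <;> simp [RingHom.algebraMap_toAlgebra]
  have : IsScalarTower k[X] A E := .of_algebraMap_eq' <| by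
    ext
    · simp [RingHom.algebraMap_toAlgebra]
    · simp [RingHom.algebraMap_toAlgebra]
      rfl
  have : IsScalarTower M E K := .of_algebraMap_eq fun r => rfl
  -- `E` is formally étale over `k[X]`: localize to `k(z)`, then extend separably. As `E` is the
  -- fraction field of `A`, this is étaleness of `A` at its generic point, which spreads to a basic
  -- open set.
  have : IsFractionRing k[X] M :=
    IsLocalization.isLocalization_of_algEquiv (nonZeroDivisors k[X]) (S := RatFunc k)
      (AlgEquiv.ofRingEquiv (f := (RatFunc.algEquivOfTranscendental z hz).toRingEquiv) fun p =>
        RatFunc.algEquivOfTranscendental_algebraMap z hz p)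
  have : Algebra.FormallyEtale k[X] M := .of_isLocalization (nonZeroDivisors k[X])
  have hEN : E ≤ (separableClosure M K).restrictScalars k := by
    rw [IntermediateField.adjoin_le_iff]
    intro t ht
    rcases Finset.mem_insert.1 ht with rfl | ht
    · exact (separableClosure M K).algebraMap_mem zM
    · exact mem_separableClosure_iff.2 (hS t ht)
  have : Algebra.IsSeparable M E :=
    ⟨fun e => IsSeparable.tower_bot (E := K) (mem_separableClosure_iff.1 (hEN e.2))⟩
  have : Algebra.FormallyEtale M E := .of_isSeparable M E
  have hE : Algebra.FormallyEtale k[X] E := .comp k[X] M E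
  have : Algebra.FiniteType k A := (Subalgebra.fg_iff_finiteType _).1 ⟨_, rfl⟩
  have : Algebra.FiniteType k[X] A := .of_restrictScalars_finiteType k k[X] A
  have : Algebra.FinitePresentation k[X] A := Algebra.FinitePresentation.of_finiteType.1 this
  have : IsLocalization (⊥ : Ideal A).primeCompl E := by
    rw [Ideal.primeCompl_bot]
    infer_instance
  have : Algebra.IsEtaleAt k[X] (⊥ : Ideal A) :=
    .of_equiv ((IsLocalization.algEquiv (⊥ : Ideal A).primeCompl E
      (Localization.AtPrime (⊥ : Ideal A))).restrictScalars k[X])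
  obtain ⟨f, hf, hR⟩ := Algebra.exists_etale_of_isEtaleAt (R := k[X]) (⊥ : Ideal A)
  let R := Localization.Away f
  have hu : ∀ y : Submonoid.powers f, IsUnit (A.val y) := by
    rintro ⟨_, n, rfl⟩
    have : (f : K) ≠ 0 := fun h => hf (Ideal.mem_bot.2 (Subtype.ext h))
    simp [this]
  let ρ : R →ₐ[k] K := IsLocalization.liftAlgHom (M := Submonoid.powers f) hu
  have hρ : ∀ a : A, ρ (algebraMap A R a) = a := fun a => IsLocalization.lift_eq _ _
  refine ⟨R, inferInstance, inferInstance, inferInstance, ?_, hR, ρ, ?_, fun s hs => ?_, ?_⟩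
  · exact .of_algebraMap_eq fun r => by
      rw [IsScalarTower.algebraMap_apply k A R, IsScalarTower.algebraMap_apply k k[X] A,
        ← IsScalarTower.algebraMap_apply k[X] A R]
  · rw [injective_iff_map_eq_zero]
    intro r hr
    obtain ⟨⟨a, s⟩, hs⟩ := IsLocalization.surj (Submonoid.powers f) r
    have ha := congrArg ρ hs
    rw [map_mul, hr, zero_mul, hρ] at ha
    have ha : a = 0 := Subtype.ext ha.symm
    rw [ha, map_zero] at hs
    exact (IsLocalization.map_units R s).mul_left_eq_zero.1 hs
  · exact ⟨algebraMap A R ⟨s, Algebra.subset_adjoin (Finset.mem_insert_of_mem hs)⟩, hρ _⟩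
  · rw [IsScalarTower.algebraMap_apply k[X] A R, hρ]
    exact congrArg Subtype.val (Polynomial.aeval_X zA)

end

end FieldTheory

/-! ### Affine images of finite sets and cardinality -/

section Counting

open Polynomial

/-- The exponent `n` and base point `z` are fixed before the list; only `t` depends on it. -/
lemma IsAmpleField.exists_shift_pow_mem {K : Type u} [Field K] [PerfectField K]
    (hK : IsAmpleField K) (q : ℕ) [ExpChar K q] {K₀ : Subfield K} {X : Set K}
    (hX : ExistentiallyDefinable (K₀ : Set K) X) {x : K} (hx : x ∈ X) (hx₀ : Transcendental K₀ x) :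
    ∃ (n : ℕ) (z : K), ∀ l : List K, ∃ t : K, t ≠ 0 ∧ ∀ c ∈ l, (z + c * t) ^ q ^ n ∈ X := by
  obtain ⟨S, hS⟩ := hX.exists_specialization hx
  obtain ⟨F, hF, hFc, hFa⟩ := exists_intermediateField_isAlgebraic_adjoin_simple hx₀
  obtain ⟨n, z, hz, hsep⟩ := exists_frobenius_root_isSeparable (k := F) q
    (fun y hy => ⟨⟨y, hFc y hy⟩, rfl⟩) x S
  have hzF : Transcendental F z := fun h => hF (hz ▸ h.pow _)
  obtain ⟨R, _, _, _, _, _, ρ, hρ, hSρ, hρX⟩ := exists_etale_of_isSeparable hzF S hsep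
  let : Algebra K₀ R := Algebra.compHom R (algebraMap K₀ F)
  have : IsScalarTower K₀ F R := .of_algebraMap_eq fun _ => rfl
  refine ⟨n, z, fun l => ?_⟩
  obtain ⟨t, ht, h⟩ := hK.exists_shift ρ l
  refine ⟨t, ht, fun c hc => ?_⟩
  obtain ⟨σ, hσ⟩ := h c hc
  have := hS R (ρ.restrictScalars K₀) (σ.restrictScalars K₀) hρ hSρ
    (algebraMap F[X] R Polynomial.X ^ q ^ n)
    (by rw [map_pow, AlgHom.restrictScalars_apply, hρX, hz])
  rwa [map_pow, AlgHom.restrictScalars_apply, hσ, hρX] at this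

open Cardinal in
/-- A set containing affine images of all finite sets, with a common base point, has as many
elements as the field outside any proper subfield. -/
lemma mk_diff_subfield_eq_of_exists_affine_image {K : Type u} [Field K] [Infinite K] {Y : Set K}
    {z : K} (hY : ∀ l : List K, ∃ t : K, t ≠ 0 ∧ ∀ c ∈ l, z + c * t ∈ Y) {L : Subfield K}
    (hL : L ≠ ⊤) : #↥(Y \ (L : Set K)) = #K := by
  classical
  obtain ⟨a, ha⟩ : ∃ a, a ∉ L := by
    by_contra! h
    exact hL (eq_top_iff.2 fun a _ => h a)
  let E : Finset K := {0, 1, a}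
  -- Avoiding the differences of `E` keeps the denominators `u + e₁ - e₀` nonzero.
  obtain ⟨u, hu⟩ := Infinite.exists_notMem_finset (E.biUnion fun e => E.image fun f => e - f)
  have hu : ∀ e ∈ E, ∀ f ∈ E, u + f - e ≠ 0 := fun e he f hf h =>
    hu (Finset.mem_biUnion.2 ⟨e, he, Finset.mem_image.2 ⟨f, hf, by linear_combination -h⟩⟩)
  let D := Y \ (L : Set K)
  have key : ∀ c : K, ∃ w₀ ∈ D, ∃ w₁ ∈ D, ∃ w₂ ∈ D, ∃ e₀ ∈ E, ∃ e₁ ∈ E, ∃ e₂ ∈ E,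
      (w₂ - w₀) / (w₁ - w₀) * (u + e₁ - e₀) - e₂ + e₀ = c := by
    intro c
    obtain ⟨t, ht, h⟩ := hY ((({0, u, c} : Finset K).biUnion fun b => E.image (b + ·)).toList)
    -- If all three points with offsets `0`, `1`, `a` lay in `L`, the ratio of their differences
    -- would put `a` in `L`.
    have hD : ∀ b ∈ ({0, u, c} : Finset K), ∃ e ∈ E, z + (b + e) * t ∈ D := by
      intro b hb
      by_contra! hn
      have hmem : ∀ e ∈ E, z + (b + e) * t ∈ L := fun e he => by
        by_contra hnot
        exact hn e he ⟨h _ (Finset.mem_toList.2 (Finset.mem_biUnion.2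
          ⟨b, hb, Finset.mem_image_of_mem _ he⟩)), hnot⟩
      have h₀ := hmem 0 (by simp [E])
      have h₁ := sub_mem (hmem 1 (by simp [E])) h₀
      have h₂ := sub_mem (hmem a (by simp [E])) h₀
      refine ha ?_
      convert div_mem h₂ h₁ using 1
      rw [eq_div_iff (by ring_nf; exact ht)]
      ring
    obtain ⟨e₀, he₀, h₀⟩ := hD 0 (by simp)
    obtain ⟨e₁, he₁, h₁⟩ := hD u (by simp)
    obtain ⟨e₂, he₂, h₂⟩ := hD c (by simp)
    refine ⟨_, h₀, _, h₁, _, h₂, e₀, he₀, e₁, he₁, e₂, he₂, ?_⟩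
    have hne := hu e₀ he₀ e₁ he₁
    have e1 : z + (u + e₁) * t - (z + (0 + e₀) * t) = (u + e₁ - e₀) * t := by ring
    rw [e1]
    field_simp
    ring
  let g : (D × D × D) × (E × E × E) → K := fun p =>
    ((p.1.2.2 : K) - p.1.1) / (p.1.2.1 - p.1.1) * (u + p.2.2.1 - p.2.1) - p.2.2.2 + p.2.1
  have hg : Function.Surjective g := fun c => by
    obtain ⟨w₀, h₀, w₁, h₁, w₂, h₂, e₀, he₀, e₁, he₁, e₂, he₂, h⟩ := key c
    exact ⟨((⟨w₀, h₀⟩, ⟨w₁, h₁⟩, ⟨w₂, h₂⟩), (⟨e₀, he₀⟩, ⟨e₁, he₁⟩, ⟨e₂, he₂⟩)), h⟩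
  refine le_antisymm (mk_set_le _) (le_of_not_gt fun hlt => ?_)
  have hK : ℵ₀ ≤ #K := aleph0_le_mk K
  have hE : #(E × E × E) < #K := (lt_aleph0_of_finite _).trans_le hK
  have hD : #(D × D × D) < #K := by
    rw [← mul_def, ← mul_def]
    exact mul_lt_of_lt hK hlt (mul_lt_of_lt hK hlt hlt)
  refine (mk_le_of_surjective hg).not_gt ?_
  rw [← mul_def]
  exact mul_lt_of_lt hK hD hE

end Counting

theorem mainTheorem4 (K : Type u) [Field K] [PerfectField K] (hK : IsAmpleField K)
    (K₀ : Subfield K) (X : Set K) (hX : ExistentiallyDefinable (K₀ : Set K) X)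
    (hX₀ : ¬ X ⊆ (algebraicClosure K₀ K : Set K))
    (K₁ : Subfield K) (hK₁ : K₁ ≠ ⊤) :
    Cardinal.mk ↥(X \ (K₁ : Set K)) = Cardinal.mk K := by
  obtain ⟨x, hx, hx'⟩ := Set.not_subset.1 hX₀
  have hx₀ : Transcendental K₀ x := fun h => hx' (mem_algebraicClosure_iff.2 h)
  have : Infinite K := by
    by_contra h
    have := not_infinite_iff_finite.1 h
    exact hx₀ (Algebra.IsAlgebraic.isAlgebraic x)
  obtain ⟨q, _⟩ := ExpChar.exists K
  obtain ⟨n, z, hz⟩ := hK.exists_shift_pow_mem q hX hx hx₀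
  let φ := iterateFrobenius K q n
  have hφ : ∀ y, φ y = y ^ q ^ n := iterateFrobenius_def q n
  -- Perfectness makes `φ` surjective, so the preimage of a proper subfield is proper.
  have hL : K₁.comap φ ≠ ⊤ := fun h => hK₁ <| eq_top_iff.2 fun y _ => by
    obtain ⟨w, rfl⟩ := (bijective_iterateFrobenius K q n).2 y
    have hw : w ∈ K₁.comap φ := h ▸ Subfield.mem_top w
    exact hw
  refine le_antisymm (Cardinal.mk_set_le _) ?_
  rw [← mk_diff_subfield_eq_of_exists_affine_image (Y := φ ⁻¹' X) (z := z) (fun l => ?_) hL]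
  · exact Cardinal.mk_le_of_injective (f := fun w : ↥(φ ⁻¹' X \ (K₁.comap φ : Set K)) =>
      (⟨φ w, w.2⟩ : ↥(X \ (K₁ : Set K)))) fun v w h =>
        Subtype.ext (φ.injective (congrArg Subtype.val h))
  · obtain ⟨t, ht, h⟩ := hz l
    exact ⟨t, ht, fun c hc => by simpa [hφ] using h c hc⟩
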